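/- Write $x\cdot y$ for the Euclidean inner product on $\mathbb{R}^2$ and $V$ for area. For a compact convex set $K\subset\mathbb{R}^2$ with the origin in its interior, let $K^{*}=\{x\in\mathbb{R}^2 : x\cdot y\le 1 \text{ for all } y\in K\}$ be its polar body and $\mathcal{P}(K)=V(K)\,V(K^{*})$ its volume product. A polygon here is a convex polygon, that is, the convex hull of finitely many points of $\mathbb{R}^2$, with non-empty interior. **Theorem 3.4.** If $P\subset\mathbb{R}^2$ is an origin-symmetric polygon ($P=-P$), then $\mathcal{P}(P)\ge\mathcal{P}(S)$ for every square $S\subset\mathbb{R}^2$ centered at the origin. -/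

import Mathlib

open MeasureTheory
open scoped ENNReal

/-- The Euclidean plane. -/
abbrev Plane : Type := EuclideanSpace ℝ (Fin 2)

/-- The polar body `K* = {x | x ⬝ y ≤ 1 for all y ∈ K}`. -/
def polarBody (K : Set Plane) : Set Plane :=
  {x | ∀ y ∈ K, inner ℝ x y ≤ 1}

/-- The volume product `V(K) V(K*)`, where `V` is two-dimensional Lebesgue measure (area). Its values
are extended nonnegative reals, so that no junk value can occur: both factors are positive and finite
when `K` is a compact convex set with the origin in its interior. -/
noncomputable def volumeProduct (K : Set Plane) : ℝ≥0∞ :=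
  volume K * volume (polarBody K)

/-- A (convex, solid, nondegenerate) polygon: the convex hull of finitely many points, with nonempty
interior. -/
def IsConvexPolygon (P : Set Plane) : Prop :=
  (∃ s : Finset Plane, P = convexHull ℝ (s : Set Plane)) ∧ (interior P).Nonempty

/-- Symmetry with respect to the origin. -/
def IsOriginSymmetric (K : Set Plane) : Prop :=
  ∀ x ∈ K, -x ∈ K

/-- A (solid, nondegenerate) square of any size and orientation with center at the origin: its
diagonals `[-a, a]` and `[-b, b]` are perpendicular and of the same positive length. -/
def IsCenteredSquare (S : Set Plane) : Prop :=
  ∃ a b : Plane, a ≠ 0 ∧ ‖a‖ = ‖b‖ ∧ inner ℝ a b = 0 ∧ S = convexHull ℝ {a, b, -a, -b}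

/-! The bound is 8, the volume product of a square. Since the product is invariant under linear
maps, a parallelogram of maximal area spanned by points of K may be made standard: K then contains
the basis and lies in `[-1, 1]²`, and so does its polar. Let A be the area of K in the open first
quadrant. Each x of K there spans a quadrilateral of area `(x 0 + x 1) / 2` with `0` and the basis,
so `(1, 1) / (2A)` is polar to K. With B the area of the polar body there, `(1, 1) / (2B)` is polar
to that body; pairing the two points gives `A * B ≥ 1/2`. A reflection handles the adjacent
quadrant, symmetry the other two, and AM-GM combines them. Of polygons, only compactness and
convexity matter. -/

/-- The linear map of the plane sending the standard basis to `u, v`. -/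
noncomputable def planeMap (u v : Plane) : Plane →ₗ[ℝ] Plane where
  toFun p := p 0 • u + p 1 • v
  map_add' p q := by
    simp only [PiLp.add_apply, add_smul]; abel
  map_smul' c p := by
    simp only [PiLp.smul_apply, smul_eq_mul, mul_smul, smul_add, RingHom.id_apply]

theorem planeMap_apply (u v p : Plane) : planeMap u v p = p 0 • u + p 1 • v := rfl

theorem planeMap_coord (u v p : Plane) (i : Fin 2) :
    planeMap u v p i = p 0 * u i + p 1 * v i := by
  simp [planeMap_apply]

theorem inner_plane (x y : Plane) : inner ℝ x y = x 0 * y 0 + x 1 * y 1 := by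
  simp [PiLp.inner_apply, Fin.sum_univ_two, mul_comm]

theorem plane_ext {x y : Plane} (h0 : x 0 = y 0) (h1 : x 1 = y 1) : x = y := by
  ext i; fin_cases i
  · exact h0
  · exact h1

theorem det_planeMap (u v : Plane) :
    LinearMap.det (planeMap u v) = u 0 * v 1 - u 1 * v 0 := by
  rw [← LinearMap.det_toMatrix (EuclideanSpace.basisFun (Fin 2) ℝ).toBasis, Matrix.det_fin_two]
  simp [LinearMap.toMatrix_apply, planeMap_coord]
  ring

/-- The adjoint transports polars and has the same determinant, so the two scaling factors cancel.
-/
theorem volumeProduct_preimage_linearMap (f : Plane →ₗ[ℝ] Plane) (hf : LinearMap.det f ≠ 0)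
    (K : Set Plane) : volumeProduct (f ⁻¹' K) = volumeProduct K := by
  have hpolar : polarBody K = LinearMap.adjoint f ⁻¹' polarBody (f ⁻¹' K) := by
    ext w
    simp only [polarBody, Set.mem_ofPred_eq, Set.mem_preimage, LinearMap.adjoint_inner_left]
    refine ⟨fun h y hy => h _ hy, fun h y hy => ?_⟩
    obtain ⟨z, rfl⟩ := (LinearMap.equivOfDetNeZero f hf).surjective y
    exact h z hy
  have hdet : LinearMap.det (LinearMap.adjoint f) = LinearMap.det f := by
    let b := EuclideanSpace.basisFun (Fin 2) ℝ
    rw [← LinearMap.det_toMatrix b.toBasis, LinearMap.toMatrix_adjoint, Matrix.det_conjTranspose,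
      LinearMap.det_toMatrix, star_trivial]
  rw [volumeProduct, volumeProduct, hpolar, Measure.addHaar_preimage_linearMap _ hf,
    Measure.addHaar_preimage_linearMap _ (hdet ▸ hf), hdet]
  ring

theorem convex_polarBody (K : Set Plane) : Convex ℝ (polarBody K) := by
  intro x hx y hy a b ha hb hab z hz
  have h1 := hx z hz
  have h2 := hy z hz
  rw [inner_add_left, inner_smul_left, inner_smul_left]
  simp only [conj_trivial]
  nlinarith

/-! ### Auerbach position -/

/-- An origin-symmetric convex set in Auerbach position: it contains the standard basis and is
contained in the square `[-1, 1]²`. -/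
structure IsAuerbach (K : Set Plane) : Prop where
  convex : Convex ℝ K
  symm : IsOriginSymmetric K
  e₀_mem : !₂[1, 0] ∈ K
  e₁_mem : !₂[0, 1] ∈ K
  abs_coord_le : ∀ z ∈ K, ∀ i, |z i| ≤ 1

theorem zero_mem_of_symmetric {K : Set Plane} (hc : Convex ℝ K) (hs : IsOriginSymmetric K)
    (hne : K.Nonempty) : (0 : Plane) ∈ K := by
  obtain ⟨z, hz⟩ := hne
  have := hc hz (hs z hz) (by norm_num : (0 : ℝ) ≤ 1 / 2) (by norm_num : (0 : ℝ) ≤ 1 / 2)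
    (by norm_num)
  simpa using this

theorem IsAuerbach.zero_mem {K : Set Plane} (hK : IsAuerbach K) : (0 : Plane) ∈ K :=
  zero_mem_of_symmetric hK.convex hK.symm ⟨_, hK.e₀_mem⟩

/-- Duality exchanges the conditions: basis points in the set bound polar coordinates, and
conversely. -/
theorem IsAuerbach.polar {K : Set Plane} (hK : IsAuerbach K) : IsAuerbach (polarBody K) where
  convex := convex_polarBody K
  symm := by
    intro x hx y hy
    have := hx (-y) (hK.symm y hy)
    rwa [inner_neg_right, ← inner_neg_left] at this
  e₀_mem := by
    intro y hy
    have := (abs_le.1 (hK.abs_coord_le y hy 0)).2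
    simpa [inner_plane] using this
  e₁_mem := by
    intro y hy
    have := (abs_le.1 (hK.abs_coord_le y hy 1)).2
    simpa [inner_plane] using this
  abs_coord_le := by
    intro z hz i
    have h0 := hz _ hK.e₀_mem
    have h1 := hz _ hK.e₁_mem
    have h0' := hz _ (hK.symm _ hK.e₀_mem)
    have h1' := hz _ (hK.symm _ hK.e₁_mem)
    simp only [inner_neg_right, inner_plane] at h0 h1 h0' h1'
    simp at h0 h1 h0' h1'
    fin_cases i <;> exact abs_le.2 ⟨by simp; linarith, by simpa⟩

/-! ### Areas in one quadrant -/

/-- The open first quadrant. -/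
def openQuadrant : Set Plane := {z | 0 < z 0 ∧ 0 < z 1}

theorem volume_box (a b : ℝ) (s : Set ℝ) (hs : volume s = ENNReal.ofReal (b - a)) :
    volume {z : Plane | ∀ i, z i ∈ s} = ENNReal.ofReal (b - a) * ENNReal.ofReal (b - a) := by
  have h := (EuclideanSpace.volume_preserving_symm_measurableEquiv_toLp (Fin 2)).measure_preimage_equiv
    (Set.univ.pi fun _ : Fin 2 => s)
  rw [volume_pi_pi] at h
  simp only [hs, Fin.prod_univ_two] at h
  rw [← h]
  congr 1
  ext z
  simp

/-- The triangle with vertices `0, (1, 0), (0, 1)`, without its two legs. -/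
def standardTriangle : Set Plane := {z | 0 < z 0 ∧ 0 < z 1 ∧ z 0 + z 1 ≤ 1}

theorem le_volume_standardTriangle : ENNReal.ofReal (1 / 2) ≤ volume standardTriangle := by
  have hsq := volume_box 0 1 (Set.Ioo 0 1) Real.volume_Ioo
  -- The triangle and its reflection in `(1/2, 1/2)` cover the open unit square.
  have hsub : {z : Plane | ∀ i, z i ∈ Set.Ioo (0 : ℝ) 1} ⊆
      standardTriangle ∪ (fun z => !₂[1, 1] - z) ⁻¹' standardTriangle := by
    intro z hz
    have h0 := hz 0
    have h1 := hz 1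
    simp only [Set.mem_Ioo] at h0 h1
    rcases le_total (z 0 + z 1) 1 with h | h
    · exact Or.inl ⟨h0.1, h1.1, h⟩
    · refine Or.inr ⟨?_, ?_, ?_⟩ <;> simp <;> linarith
  have h1 := (measure_mono hsub).trans (measure_union_le (μ := volume) _ _)
  have hrefl : volume ((fun z : Plane => !₂[1, 1] - z) ⁻¹' standardTriangle) =
      volume standardTriangle :=
    (Measure.measurePreserving_sub_left volume (!₂[1, 1] : Plane)).measure_preimage_emb
      (MeasurableEquiv.subLeft (!₂[1, 1] : Plane)).measurableEmbedding _
  rw [hrefl, hsq, ← two_mul] at h1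
  have h2 : ENNReal.ofReal (1 / 2) = 2⁻¹ := by
    rw [one_div, ENNReal.ofReal_inv_of_pos two_pos]; simp
  rw [h2, ENNReal.inv_le_iff_le_mul] <;> simp_all

theorem le_volume_image_standardTriangle (u v : Plane) {c : ℝ} (hc : 0 ≤ c)
    (h : u 0 * v 1 - u 1 * v 0 = c) :
    ENNReal.ofReal (c / 2) ≤ volume (planeMap u v '' standardTriangle) := by
  rw [Measure.addHaar_image_linearMap, det_planeMap, h, abs_of_nonneg hc, div_eq_mul_one_div,
    ENNReal.ofReal_mul hc]
  gcongr
  exact le_volume_standardTriangle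

theorem image_standardTriangle_subset {K : Set Plane} (hc : Convex ℝ K) (h0 : (0 : Plane) ∈ K)
    {u v : Plane} (hu : u ∈ K) (hv : v ∈ K) : planeMap u v '' standardTriangle ⊆ K := by
  rintro _ ⟨z, ⟨hz0, hz1, hz⟩, rfl⟩
  rw [planeMap_apply]
  have hpos : 0 < z 0 + z 1 := by linarith
  have h1 := hc hu hv (a := z 0 / (z 0 + z 1)) (b := z 1 / (z 0 + z 1)) (by positivity)
    (by positivity) (by field_simp)
  have h2 := hc.smul_mem_of_zero_mem h0 h1 ⟨hpos.le, hz⟩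
  convert h2 using 1
  rw [smul_add, smul_smul, smul_smul]
  congr 2 <;> field_simp

/-- The quadrilateral with vertices `0, (1, 0), x, (0, 1)` has area `(x₀ + x₁) / 2`. -/
theorem le_volume_inter_openQuadrant {K : Set Plane} (hK : IsAuerbach K) {x : Plane} (hx : x ∈ K)
    (hx0 : 0 < x 0) (hx1 : 0 < x 1) :
    ENNReal.ofReal ((x 0 + x 1) / 2) ≤ volume (K ∩ openQuadrant) := by
  -- The line through `0` and `x` cuts the quadrilateral into two triangles.
  have hM : MeasurableSet {z : Plane | x 0 * z 1 - x 1 * z 0 < 0} :=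
    (isOpen_lt (by fun_prop) continuous_const).measurableSet
  rw [← measure_inter_add_sdiff (K ∩ openQuadrant) hM, add_comm (x 0), add_div,
    ENNReal.ofReal_add (by positivity) (by positivity)]
  gcongr
  · refine (le_volume_image_standardTriangle !₂[1, 0] x hx1.le (by simp)).trans (measure_mono ?_)
    intro w hw
    refine ⟨⟨image_standardTriangle_subset hK.convex hK.zero_mem hK.e₀_mem hx hw, ?_⟩, ?_⟩
    all_goals
      obtain ⟨z, ⟨hz0, hz1, -⟩, rfl⟩ := hw
      simp only [openQuadrant, Set.mem_ofPred_eq, planeMap_coord]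
      simp
    · constructor <;> positivity
    · nlinarith [mul_pos hz0 hx1]
  · refine (le_volume_image_standardTriangle x !₂[0, 1] hx0.le (by simp)).trans (measure_mono ?_)
    intro w hw
    refine ⟨⟨image_standardTriangle_subset hK.convex hK.zero_mem hx hK.e₁_mem hw, ?_⟩, ?_⟩
    all_goals
      obtain ⟨z, ⟨hz0, hz1, -⟩, rfl⟩ := hw
      simp only [openQuadrant, Set.mem_ofPred_eq, planeMap_coord]
      simp
    · constructor <;> positivity
    · nlinarith [mul_pos hz1 hx0]

theorem IsAuerbach.volume_lt_top {K : Set Plane} (hK : IsAuerbach K) : volume K < ∞ := by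
  have h := volume_box (-1) 1 (Set.Icc (-1) 1) Real.volume_Icc
  refine (measure_mono fun z hz i => abs_le.1 (hK.abs_coord_le z hz i)).trans_lt (h.trans_lt ?_)
  exact ENNReal.mul_lt_top ENNReal.ofReal_lt_top ENNReal.ofReal_lt_top

/-- The area of the part of `K` in the open first quadrant. -/
noncomputable def quadrantArea (K : Set Plane) : ℝ := volume.real (K ∩ openQuadrant)

theorem quadrantArea_nonneg (K : Set Plane) : 0 ≤ quadrantArea K := ENNReal.toReal_nonneg

theorem IsAuerbach.ofReal_quadrantArea {K : Set Plane} (hK : IsAuerbach K) :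
    ENNReal.ofReal (quadrantArea K) = volume (K ∩ openQuadrant) :=
  ENNReal.ofReal_toReal ((measure_mono Set.inter_subset_left).trans_lt hK.volume_lt_top).ne

theorem IsAuerbach.sum_le {K : Set Plane} (hK : IsAuerbach K) {x : Plane} (hx : x ∈ K)
    (hx0 : 0 < x 0) (hx1 : 0 < x 1) : x 0 + x 1 ≤ 2 * quadrantArea K := by
  have h := le_volume_inter_openQuadrant hK hx hx0 hx1
  rw [← hK.ofReal_quadrantArea, ENNReal.ofReal_le_ofReal_iff (quadrantArea_nonneg K)] at h
  linarith

theorem IsAuerbach.one_le_two_mul_quadrantArea {K : Set Plane} (hK : IsAuerbach K) :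
    1 ≤ 2 * quadrantArea K := by
  have h := hK.convex hK.e₀_mem hK.e₁_mem (by norm_num : (0 : ℝ) ≤ 1 / 2)
    (by norm_num : (0 : ℝ) ≤ 1 / 2) (by norm_num)
  have := hK.sum_le h (by simp) (by simp)
  simp at this
  linarith

theorem IsAuerbach.diagonal_mem_polarBody {K : Set Plane} (hK : IsAuerbach K) :
    (2 * quadrantArea K)⁻¹ • (!₂[1, 1] : Plane) ∈ polarBody K := by
  intro x hx
  have hA := hK.one_le_two_mul_quadrantArea
  have hsum : x 0 + x 1 ≤ 2 * quadrantArea K := by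
    -- Outside the quadrant some coordinate is nonpositive and the other at most 1, so a sum above 1
    -- forces `x` inside.
    rcases le_or_gt (x 0 + x 1) 1 with h | h
    · linarith
    · have h0 := (abs_le.1 (hK.abs_coord_le x hx 0)).2
      have h1 := (abs_le.1 (hK.abs_coord_le x hx 1)).2
      exact hK.sum_le hx (by linarith) (by linarith)
  rw [inner_smul_left, inner_plane]
  simp only [conj_trivial]
  rw [inv_mul_le_iff₀ (by linarith)]
  simpa using hsum

theorem IsAuerbach.half_le_mul_quadrantArea {K : Set Plane} (hK : IsAuerbach K) :
    1 / 2 ≤ quadrantArea K * quadrantArea (polarBody K) := by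
  have hp := hK.diagonal_mem_polarBody
  have hq := hK.polar.diagonal_mem_polarBody _ hp
  have hA := hK.one_le_two_mul_quadrantArea
  have hB := hK.polar.one_le_two_mul_quadrantArea
  rw [inner_smul_left, inner_smul_right, inner_plane] at hq
  simp only [conj_trivial] at hq
  rw [inv_mul_le_iff₀ (by linarith), inv_mul_le_iff₀ (by linarith)] at hq
  simp at hq
  linarith

/-! ### Assembling the four quadrants -/

/-- The reflection in the second coordinate axis. -/
noncomputable def planeReflection : Plane →ₗ[ℝ] Plane := planeMap !₂[-1, 0] !₂[0, 1]

theorem planeReflection_zero (z : Plane) : planeReflection z 0 = -z 0 := by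
  simp [planeReflection, planeMap_coord]

theorem planeReflection_one (z : Plane) : planeReflection z 1 = z 1 := by
  simp [planeReflection, planeMap_coord]

theorem planeReflection_planeReflection (z : Plane) : planeReflection (planeReflection z) = z :=
  plane_ext (by simp [planeReflection_zero]) (by simp [planeReflection_one])

theorem volume_preimage_planeReflection (K : Set Plane) :
    volume (planeReflection ⁻¹' K) = volume K := by
  have hdet : LinearMap.det planeReflection = -1 := by simp [planeReflection, det_planeMap]
  rw [Measure.addHaar_preimage_linearMap _ (by simp [hdet]), hdet]
  simp

theorem polarBody_preimage_planeReflection (K : Set Plane) :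
    polarBody (planeReflection ⁻¹' K) = planeReflection ⁻¹' polarBody K := by
  have hadj (x y : Plane) : inner ℝ (planeReflection x) y = inner ℝ x (planeReflection y) := by
    simp [inner_plane, planeReflection_zero, planeReflection_one]
  ext x
  refine ⟨fun h y hy => ?_, fun h y hy => ?_⟩
  · rw [hadj]
    exact h _ (by simpa [planeReflection_planeReflection] using hy)
  · have := h _ hy
    rwa [hadj, planeReflection_planeReflection] at this

theorem IsAuerbach.preimage_planeReflection {K : Set Plane} (hK : IsAuerbach K) :
    IsAuerbach (planeReflection ⁻¹' K) where
  convex := hK.convex.linear_preimage _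
  symm := by
    intro x hx
    simpa using hK.symm _ hx
  e₀_mem := by
    have : planeReflection !₂[1, 0] = -!₂[1, 0] :=
      plane_ext (by simp [planeReflection_zero]) (by simp [planeReflection_one])
    rw [Set.mem_preimage, this]
    exact hK.symm _ hK.e₀_mem
  e₁_mem := by
    have : planeReflection !₂[0, 1] = !₂[0, 1] :=
      plane_ext (by simp [planeReflection_zero]) (by simp [planeReflection_one])
    rw [Set.mem_preimage, this]
    exact hK.e₁_mem
  abs_coord_le := by
    intro z hz i
    have := hK.abs_coord_le _ hz i
    fin_cases i
    · simpa [planeReflection_zero] using this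
    · simpa [planeReflection_one] using this

/-- A set in Auerbach position contains four pieces, in the four quadrants, equal in opposite pairs. -/
theorem IsAuerbach.le_volume {K : Set Plane} (hK : IsAuerbach K) :
    ENNReal.ofReal (2 * (quadrantArea K + quadrantArea (planeReflection ⁻¹' K))) ≤ volume K := by
  have hH : MeasurableSet {z : Plane | 0 < z 1} :=
    (isOpen_lt continuous_const (by fun_prop)).measurableSet
  have hG : MeasurableSet {z : Plane | 0 < z 0} :=
    (isOpen_lt continuous_const (by fun_prop)).measurableSet
  have hupper : volume (K ∩ openQuadrant) + volume (planeReflection ⁻¹' K ∩ openQuadrant) ≤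
      volume (K ∩ {z | 0 < z 1}) := by
    rw [← measure_inter_add_sdiff (K ∩ {z : Plane | 0 < z 1}) hG]
    refine add_le_add ?_ ?_
    · exact measure_mono fun z hz => ⟨⟨hz.1, hz.2.2⟩, hz.2.1⟩
    · rw [← volume_preimage_planeReflection]
      refine measure_mono fun z hz => ?_
      have h0 := hz.2.1
      have h1 := hz.2.2
      rw [planeReflection_zero] at h0
      rw [planeReflection_one] at h1
      refine ⟨⟨?_, h1⟩, ?_⟩
      · simpa [planeReflection_planeReflection] using hz.1
      · simp only [Set.mem_ofPred_eq]; linarith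
  have hlower : volume (K ∩ {z : Plane | 0 < z 1}) ≤ volume (K \ {z : Plane | 0 < z 1}) := by
    rw [← Measure.measure_neg]
    refine measure_mono fun z hz => ⟨by simpa using hK.symm _ hz.1, ?_⟩
    have := hz.2
    simp only [Set.mem_ofPred_eq, PiLp.neg_apply] at this ⊢
    linarith
  rw [ENNReal.ofReal_mul zero_le_two,
    ENNReal.ofReal_add (quadrantArea_nonneg _) (quadrantArea_nonneg _), hK.ofReal_quadrantArea,
    hK.preimage_planeReflection.ofReal_quadrantArea, ← measure_inter_add_sdiff K hH,
    ENNReal.ofReal_ofNat, two_mul]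
  exact add_le_add hupper (hupper.trans hlower)

/-- The cross terms satisfy `a * d + b * c ≥ 1` by AM-GM, their product being `(a * c) * (b * d) ≥
1/4`. -/
theorem eight_le_of_half_le_mul {a b c d : ℝ} (ha : 0 ≤ a) (hb : 0 ≤ b) (hc : 0 ≤ c) (hd : 0 ≤ d)
    (hac : 1 / 2 ≤ a * c) (hbd : 1 / 2 ≤ b * d) : 8 ≤ 2 * (a + b) * (2 * (c + d)) := by
  have hprod : 1 / 4 ≤ (a * d) * (b * c) := by nlinarith
  have : 1 ≤ a * d + b * c := by
    nlinarith [sq_nonneg (a * d - b * c), mul_nonneg ha hd, mul_nonneg hb hc]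
  nlinarith

theorem IsAuerbach.eight_le_volumeProduct {K : Set Plane} (hK : IsAuerbach K) :
    8 ≤ volumeProduct K := by
  have h1 := hK.half_le_mul_quadrantArea
  have h2 := hK.preimage_planeReflection.half_le_mul_quadrantArea
  rw [polarBody_preimage_planeReflection] at h2
  have h := eight_le_of_half_le_mul (quadrantArea_nonneg _) (quadrantArea_nonneg _)
    (quadrantArea_nonneg _) (quadrantArea_nonneg _) h1 h2
  calc (8 : ℝ≥0∞) = ENNReal.ofReal 8 := by simp
    _ ≤ _ := ENNReal.ofReal_le_ofReal h
    _ = _ := ENNReal.ofReal_mul (mul_nonneg zero_le_two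
      (add_nonneg (quadrantArea_nonneg _) (quadrantArea_nonneg _)))
    _ ≤ _ := mul_le_mul' hK.le_volume hK.polar.le_volume

/-! ### Reduction to Auerbach position -/

/-- A pair of points of `K` spanning a parallelogram of maximal area. -/
theorem exists_max_det {K : Set Plane} (hK : IsCompact K) (hint : (interior K).Nonempty) :
    ∃ u ∈ K, ∃ v ∈ K, 0 < u 0 * v 1 - u 1 * v 0 ∧
      ∀ x ∈ K, ∀ y ∈ K, x 0 * y 1 - x 1 * y 0 ≤ u 0 * v 1 - u 1 * v 0 := by
  have hne : K.Nonempty := hint.mono interior_subset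
  obtain ⟨⟨u, v⟩, ⟨hu, hv⟩, hmax⟩ := (hK.prod hK).exists_isMaxOn (hne.prod hne)
    (f := fun p : Plane × Plane => p.1 0 * p.2 1 - p.1 1 * p.2 0) (by fun_prop)
  have hmax' : ∀ x ∈ K, ∀ y ∈ K, x 0 * y 1 - x 1 * y 0 ≤ u 0 * v 1 - u 1 * v 0 :=
    fun x hx y hy => hmax (Set.mk_mem_prod hx hy)
  refine ⟨u, hu, v, hv, ?_, hmax'⟩
  -- Otherwise antisymmetry makes all determinants on `K` vanish, which fails for an interior point
  -- and its small shifts along the axes.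
  by_contra! hle
  obtain ⟨z, hz⟩ := hint
  have hnhds : K ∈ nhds z := mem_interior_iff_mem_nhds.1 hz
  have hev (w : Plane) : ∀ᶠ t : ℝ in nhdsWithin 0 (Set.Ioi 0), z + t • w ∈ K := by
    have hc : ContinuousAt (fun t : ℝ => z + t • w) 0 := by fun_prop
    exact (hc.eventually_mem (by simpa using hnhds)).filter_mono nhdsWithin_le_nhds
  obtain ⟨t, ht0, ht1, ht2, ht⟩ :=
    ((hev !₂[1, 0]).and ((hev !₂[0, 1]).and ((hev !₂[1, 1]).and self_mem_nhdsWithin))).exists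
  have ht' : (0 : ℝ) < t := ht
  have hz := interior_subset hz
  have key : ∀ x ∈ K, ∀ y ∈ K, x 0 * y 1 - x 1 * y 0 = 0 := fun x hx y hy => by
    have := hmax' x hx y hy
    have := hmax' y hy x hx
    linarith
  have a1 := key _ hz _ ht0
  have a2 := key _ hz _ ht1
  have a3 := key _ ht0 _ ht1
  simp at a1 a2 a3
  nlinarith

theorem eight_le_volumeProduct {K : Set Plane} (hc : Convex ℝ K) (hK : IsCompact K)
    (hs : IsOriginSymmetric K) (hint : (interior K).Nonempty) : 8 ≤ volumeProduct K := by
  obtain ⟨u, hu, v, hv, hpos, hmax⟩ := exists_max_det hK hint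
  have hdet := det_planeMap u v
  rw [← volumeProduct_preimage_linearMap (planeMap u v) (hdet ▸ hpos.ne')]
  apply IsAuerbach.eight_le_volumeProduct
  -- By Cramer's rule the coordinates are ratios of determinants to the maximal one.
  have hcoord (z : Plane) (hz : planeMap u v z ∈ K) : z 0 ≤ 1 ∧ z 1 ≤ 1 := by
    have h0 := hmax _ hz _ hv
    have h1 := hmax _ hu _ hz
    simp only [planeMap_coord] at h0 h1
    constructor <;> by_contra! h <;> nlinarith [mul_pos (sub_pos.2 h) hpos]
  have hsymm : IsOriginSymmetric (planeMap u v ⁻¹' K) := by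
    intro x hx
    simpa using hs _ hx
  refine ⟨hc.linear_preimage _, hsymm, ?_, ?_, ?_⟩
  · simpa [planeMap_apply] using hu
  · simpa [planeMap_apply] using hv
  · intro z hz i
    have h1 := hcoord z hz
    have h2 := hcoord (-z) (hsymm z hz)
    simp only [PiLp.neg_apply] at h2
    fin_cases i <;> exact abs_le.2 ⟨by simp; linarith, by simp; linarith⟩

/-! ### The square -/

/-- The unit ball of the `ℓ¹` norm, as intersection of two strips. -/
def crossPolygon : Set Plane := {z | ∀ i, planeMap !₂[1, 1] !₂[1, -1] z i ∈ Set.Icc (-1 : ℝ) 1}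

theorem volumeProduct_crossPolygon_le : volumeProduct crossPolygon ≤ 8 := by
  have hbox := volume_box (-1) 1 (Set.Icc (-1) 1) Real.volume_Icc
  have hdet : LinearMap.det (planeMap !₂[1, 1] !₂[1, -1]) = -2 := by
    rw [det_planeMap]; norm_num
  have h1 : volume crossPolygon = 2 := by
    have h := Measure.addHaar_preimage_linearMap (volume : Measure Plane)
      (f := planeMap !₂[1, 1] !₂[1, -1]) (by rw [hdet]; norm_num)
      {z : Plane | ∀ i, z i ∈ Set.Icc (-1 : ℝ) 1}
    rw [hbox, hdet, ← ENNReal.ofReal_mul (by norm_num), ← ENNReal.ofReal_mul (by positivity)] at h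
    refine Eq.trans h ?_
    norm_num [abs_of_pos]
  have h2 : volume (polarBody crossPolygon) ≤ 4 := by
    have : polarBody crossPolygon ⊆ {z : Plane | ∀ i, z i ∈ Set.Icc (-1 : ℝ) 1} := by
      intro z hz
      have hmem (w : Plane) (hw : |w 0 + w 1| ≤ 1) (hw' : |w 0 - w 1| ≤ 1) :
          z 0 * w 0 + z 1 * w 1 ≤ 1 := by
        rw [← inner_plane]
        refine hz w fun i => abs_le.1 ?_
        rw [planeMap_coord]
        fin_cases i
        · simpa using hw
        · simpa [sub_eq_add_neg] using hw'
      have a := hmem !₂[1, 0] (by simp) (by simp)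
      have b := hmem !₂[-1, 0] (by simp) (by simp)
      have c := hmem !₂[0, 1] (by simp) (by simp)
      have d := hmem !₂[0, -1] (by simp) (by simp)
      simp at a b c d
      intro i
      fin_cases i
      · exact ⟨by simp; linarith, by simpa⟩
      · exact ⟨by simp; linarith, by simpa⟩
    refine (measure_mono this).trans (hbox.trans ?_).le
    rw [← ENNReal.ofReal_mul (by norm_num)]
    norm_num
  calc volumeProduct crossPolygon ≤ 2 * 4 := mul_le_mul' h1.le h2
    _ = 8 := by norm_num

theorem convexHull_eq_crossPolygon :
    convexHull ℝ {!₂[1, 0], !₂[0, 1], -!₂[1, 0], -!₂[0, 1]} = crossPolygon := by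
  apply Set.Subset.antisymm
  · apply convexHull_min
    · intro z hz i
      simp only [Set.mem_insert_iff, Set.mem_singleton_iff] at hz
      rcases hz with rfl | rfl | rfl | rfl <;> fin_cases i <;> simp [planeMap_coord]
    · intro x hx y hy a b ha hb hab i
      have := convex_Icc (-1 : ℝ) 1 (hx i) (hy i) ha hb hab
      simpa using this
  · intro z hz
    have h0 := hz 0
    have h1 := hz 1
    simp [planeMap_coord] at h0 h1
    set V : Set Plane := {!₂[1, 0], !₂[0, 1], -!₂[1, 0], -!₂[0, 1]}
    have hc := convex_convexHull ℝ V
    have hmem (w : Plane) (hw : w ∈ V) : w ∈ convexHull ℝ V := subset_convexHull ℝ V hw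
    -- In the coordinates `z 0 ± z 1` the body is a square, so bilinear weights express `z` through
    -- the vertices.
    have hs0 : 0 ≤ (1 + z 0 + z 1) / 2 := by linarith
    have hs1 : 0 ≤ (1 - z 0 - z 1) / 2 := by linarith
    have ht0 : 0 ≤ (1 + z 0 - z 1) / 2 := by linarith
    have ht1 : 0 ≤ (1 - z 0 + z 1) / 2 := by linarith
    have hp := hc (hmem !₂[1, 0] (by simp [V])) (hmem !₂[0, 1] (by simp [V])) ht0 ht1 (by ring)
    have hq := hc (hmem (-!₂[0, 1]) (by simp [V])) (hmem (-!₂[1, 0]) (by simp [V])) ht0 ht1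
      (by ring)
    convert hc hp hq hs0 hs1 (by ring) using 1
    apply plane_ext <;> simp <;> ring

theorem preimage_convexHull_eq_crossPolygon (a b : Plane)
    (hdet : LinearMap.det (planeMap a b) ≠ 0) :
    planeMap a b ⁻¹' convexHull ℝ {a, b, -a, -b} = crossPolygon := by
  have hinj : Function.Injective (planeMap a b) :=
    (LinearMap.equivOfDetNeZero (planeMap a b) hdet).injective
  have himage : planeMap a b '' {!₂[1, 0], !₂[0, 1], -!₂[1, 0], -!₂[0, 1]} = {a, b, -a, -b} := by
    simp [Set.image_insert_eq, planeMap_apply]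
  rw [← himage, ← LinearMap.image_convexHull, Set.preimage_image_eq _ hinj,
    convexHull_eq_crossPolygon]

theorem volumeProduct_square_le {S : Set Plane} (hS : IsCenteredSquare S) :
    volumeProduct S ≤ 8 := by
  obtain ⟨a, b, ha, hab, horth, rfl⟩ := hS
  have hdet : LinearMap.det (planeMap a b) ≠ 0 := by
    rw [det_planeMap]
    intro h
    have hn : inner ℝ a a = inner ℝ b b := by
      rw [real_inner_self_eq_norm_sq, real_inner_self_eq_norm_sq, hab]
    have hpos : 0 < inner ℝ a a := real_inner_self_pos.2 ha
    rw [inner_plane] at hn hpos horth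
    rw [inner_plane] at hn
    -- Lagrange's identity: the squared determinant plus the squared inner product is `‖a‖² * ‖b‖²`,
    -- which is positive.
    nlinarith [sq_nonneg (a 0 * b 0 + a 1 * b 1), mul_pos hpos hpos]
  rw [← volumeProduct_preimage_linearMap _ hdet, preimage_convexHull_eq_crossPolygon a b hdet]
  exact volumeProduct_crossPolygon_le

theorem theorem3p4 (P S : Set Plane) (hP : IsConvexPolygon P) (hsymm : IsOriginSymmetric P)
    (hS : IsCenteredSquare S) :
    volumeProduct S ≤ volumeProduct P := by
  obtain ⟨⟨s, rfl⟩, hint⟩ := hP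
  exact (volumeProduct_square_le hS).trans (eight_le_volumeProduct (convex_convexHull ℝ _)
    (s.finite_toSet.isCompact_convexHull ℝ) hsymm hint)
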